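/- Let $\nu$ be a $\sigma$-finite measure on $\mathbb R$ and let $p_0\ge 0$ be a probability density with respect to $\nu$ whose distribution $P_0=p_0\,\nu$ is symmetric around zero and is not the point mass at $0$ (this last condition is automatic when $\nu$ is Lebesgue measure). Assume that the log-MGF $\kappa(\theta)=\log\int e^{\theta x}p_0(x)\,\nu(dx)$ is finite for every $\theta\in\mathbb R$, and put $p_\theta(x)=e^{\theta x-\kappa(\theta)}p_0(x)$ for $\theta\in\mathbb R$. For a probability measure $\pi$ on $\mathbb R$ let $p_\pi(x)=\int p_\theta(x)\,\pi(d\theta)$. A nonparametric maximum likelihood estimator (NPMLE) for data $x_1,\dots,x_n$ is a maximizer $\hat\pi$ of $\frac1n\sum_{i=1}^n\log p_\pi(x_i)$ over all probability measures $\pi$ on $\mathbb R$ (with $\log 0=-\infty$). Theorem. Fix $2<K_0\le K_1$ and $b,\beta>0$. There is a constant $C>0$ depending only on $(K_0,K_1,\beta,b)$ and, for every $\theta_0>0$ and $v>0$, an integer $n_0$ depending only on $(K_0,K_1,\beta,b,\theta_0,v)$, with the following property. Let $(\nu,p_0)$ be as above with $\kappa(\theta_0)=v$ and $$K_0\,\kappa(\theta)\le\kappa(2\theta)\le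 K_1\,\kappa(\theta)\qquad\text{for all } |\theta|>\theta_0 .$$ Let $\pi$ be a mixing distribution supported on $[-b,b]$, let $n\ge n_0$, and let $x_1,\dots,x_n$ be i.i.d. with density $p_\pi$ with respect to $\nu$. Then, with probability at least $1-2n^{-\beta}$, an NPMLE exists and every NPMLE $\hat\pi$ has at most $C\log n$ atoms, that is, its support is finite with $|\mathrm{supp}(\hat\pi)|\le C\log n$. -/

import Mathlib

open MeasureTheory ProbabilityTheory
open scoped ENNReal NNReal

noncomputable section

namespace ExpFamily

/-- The base distribution: the measure with density `p₀` with respect to the dominating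
measure `ν`. -/
def baseLaw (ν : Measure ℝ) (p₀ : ℝ → ℝ≥0) : Measure ℝ :=
  ν.withDensity (fun x => (p₀ x : ℝ≥0∞))

/-- The log-MGF `κ(θ) = log E_{X ∼ p₀}[exp (θ X)]` of the base density. -/
def logMGF (ν : Measure ℝ) (p₀ : ℝ → ℝ≥0) (θ : ℝ) : ℝ :=
  cgf id (baseLaw ν p₀) θ

/-- The member `p_θ(x) = exp (θ x - κ(θ)) p₀(x)` of the exponential family. -/
def density (ν : Measure ℝ) (p₀ : ℝ → ℝ≥0) (θ x : ℝ) : ℝ≥0∞ :=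
  ENNReal.ofReal (Real.exp (θ * x - logMGF ν p₀ θ)) * (p₀ x : ℝ≥0∞)

/-- The mixture density `p_π(x) = ∫ p_θ(x) π(dθ)`. -/
def mixDensity (ν : Measure ℝ) (p₀ : ℝ → ℝ≥0) (π : ProbabilityMeasure ℝ) (x : ℝ) : ℝ≥0∞ :=
  ∫⁻ θ, density ν p₀ θ x ∂(π : Measure ℝ)

/-- The distribution on `ℝ` with density `p_π` with respect to `ν`. -/
def mixLaw (ν : Measure ℝ) (p₀ : ℝ → ℝ≥0) (π : ProbabilityMeasure ℝ) : Measure ℝ :=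
  ν.withDensity (mixDensity ν p₀ π)

/-- The average log-likelihood `(1/n) ∑ i, log p_π(x i)`, with `log 0 = -∞`. -/
def logLik (ν : Measure ℝ) (p₀ : ℝ → ℝ≥0) {n : ℕ} (x : Fin n → ℝ)
    (π : ProbabilityMeasure ℝ) : EReal :=
  (((n : ℝ)⁻¹ : ℝ) : EReal) * ∑ i, ENNReal.log (mixDensity ν p₀ π (x i))

/-- `πhat` is a nonparametric maximum likelihood estimator for the data `x`: it maximizes the
log-likelihood over all probability measures on the parameter space `ℝ`. -/
def IsNPMLE (ν : Measure ℝ) (p₀ : ℝ → ℝ≥0) {n : ℕ} (x : Fin n → ℝ)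
    (πhat : ProbabilityMeasure ℝ) : Prop :=
  ∀ π : ProbabilityMeasure ℝ, logLik ν p₀ x π ≤ logLik ν p₀ x πhat

/-- `π` is supported on finitely many points, and their number is at most the real number `m`. -/
def AtMostAtoms (π : ProbabilityMeasure ℝ) (m : ℝ) : Prop :=
  (π : Measure ℝ).support.Finite ∧ ((π : Measure ℝ).support.ncard : ℝ) ≤ m

end ExpFamily

end

/-! Write `M = exp κ` for the moment generating function of the base law. At a maximizer,
perturbation towards a point mass gives `∑ i, f i θ / u i ≤ n`, where `f i θ = exp (θ x i - κ θ)`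
and `u i` is its mean under the maximizer, with equality on the support. Multiplied by `M θ / n`,
the equality says that every atom is a real zero of the entire function `M - F`, where `F θ = ∑ i, w
i * exp (θ x i)` and `w i = 1 / (n u i)`. The inequality at `θ = 0` says that the weights have total
mass at most one.

If all `|x i| ≤ t`, then `F θ ≤ exp (|θ| t)`. Let `r` satisfy `κ r ≥ r t + log 2`. Since `κ θ / θ`
is nondecreasing on the positive axis, `κ` beats `|θ| t` for all `|θ| ≥ r`, so all zeros lie in
`(-r, r)`. At `r` itself `M - F ≥ 1/2`, so a Jensen-type bound controls the number of zeros by a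
constant plus `κ (8r) / log 2` (`card_mgf_eq_sum_exp_le`). The same cone bound gives existence, as
the kernels are at most their value at `0` outside `[-r, r]`.

It remains to choose scales. Take `κ s = log n` and `t` of order `log n / s`. A Chernoff bound keeps
the sample in `[-t, t]`. Because `K₀ > 2`, `κ` outgrows linear functions under doubling, so `r = 2 ^
k * s` works for a fixed `k`; the upper growth bound gives `κ (8r) ≤ K₁ ^ (k + 3) * log n`. -/

namespace ExpFamily

open Filter Topology

/-! ### Counting zeros of entire functions -/

/-- An entire function is divisible by the product over any finite set of its zeros. -/
theorem exists_eq_prod_sub_mul {f : ℂ → ℂ} (hf : Differentiable ℂ f) (s : Finset ℂ)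
    (hs : ∀ a ∈ s, f a = 0) :
    ∃ g : ℂ → ℂ, Differentiable ℂ g ∧ ∀ z, f z = (∏ a ∈ s, (z - a)) * g z := by
  classical
  induction s using Finset.induction_on with
  | empty => exact ⟨f, hf, by simp⟩
  | insert b s hb ih =>
    obtain ⟨g, hg, hfg⟩ := ih fun a ha => hs a (Finset.mem_insert_of_mem ha)
    have hgb : g b = 0 := by
      have h := hfg b
      rw [hs b (Finset.mem_insert_self b s)] at h
      refine (mul_eq_zero.1 h.symm).resolve_left (Finset.prod_ne_zero_iff.2 fun a ha => ?_)
      exact sub_ne_zero.2 fun h => hb (h ▸ ha)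
    refine ⟨dslope g b, ?_, fun z => ?_⟩
    · rw [← differentiableOn_univ]
      exact (Complex.differentiableOn_dslope Filter.univ_mem).2 hg.differentiableOn
    · have h := sub_smul_dslope g b z
      rw [hgb, sub_zero, smul_eq_mul] at h
      rw [Finset.prod_insert hb, hfg z, ← h]
      ring

/-- A Jensen-type bound for the number of zeros of an entire function in a disc. -/
theorem two_pow_card_zeros_mul_le {f : ℂ → ℂ} (hf : Differentiable ℂ f) {c : ℂ} {ρ M : ℝ}
    (hρ : 0 < ρ) (hM : ∀ z, ‖z - c‖ = 3 * ρ → ‖f z‖ ≤ M) (s : Finset ℂ)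
    (hs : ∀ a ∈ s, f a = 0) (hsρ : ∀ a ∈ s, ‖a - c‖ ≤ ρ) :
    2 ^ s.card * ‖f c‖ ≤ M := by
  obtain ⟨g, hg, hfg⟩ := exists_eq_prod_sub_mul hf s hs
  -- Maximum principle for the quotient: on the sphere of radius `3 * ρ` each factor has modulus at
  -- least `2 * ρ`, while at the centre it is at most `ρ`. Each zero thus gains a factor `2`.
  have hgc : ‖g c‖ ≤ M / (2 * ρ) ^ s.card := by
    refine Complex.norm_le_of_forall_mem_frontier_norm_le (U := Metric.ball c (3 * ρ))
      Metric.isBounded_ball hg.diffContOnCl (fun z hz => ?_)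
      (subset_closure (Metric.mem_ball_self (by positivity)))
    rw [frontier_ball _ (by positivity), mem_sphere_iff_norm] at hz
    rw [le_div_iff₀ (by positivity), mul_comm]
    refine le_trans ?_ (hM z hz)
    rw [hfg z, norm_mul, norm_prod]
    refine mul_le_mul_of_nonneg_right ?_ (norm_nonneg _)
    rw [← Finset.prod_const]
    refine Finset.prod_le_prod (fun _ _ => by positivity) fun a ha => ?_
    have h1 : ‖z - c‖ ≤ ‖z - a‖ + ‖a - c‖ := by
      simpa using norm_add_le (z - a) (a - c)
    linarith [hsρ a ha]
  rw [le_div_iff₀ (by positivity)] at hgc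
  refine le_trans ?_ hgc
  rw [hfg c, norm_mul, norm_prod]
  calc 2 ^ s.card * ((∏ a ∈ s, ‖c - a‖) * ‖g c‖)
      ≤ 2 ^ s.card * ((∏ _a ∈ s, ρ) * ‖g c‖) := by
        gcongr with a ha
        rw [norm_sub_rev]
        exact hsρ a ha
    _ = ‖g c‖ * (2 * ρ) ^ s.card := by
        rw [Finset.prod_const, mul_pow]
        ring

/-! ### Maximizers of products of mixtures: existence and first-order conditions -/

section Maximizer

variable {ι : Type*} [Fintype ι]

theorem integrable_of_bounded_continuous {f : ℝ → ℝ} (hf : Continuous f) {B : ℝ}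
    (h0 : ∀ θ, 0 < f θ) (hB : ∀ θ, f θ ≤ B) (π : ProbabilityMeasure ℝ) :
    Integrable f (π : Measure ℝ) :=
  Integrable.of_bound hf.aestronglyMeasurable B
    (ae_of_all _ fun θ => by rw [Real.norm_of_nonneg (h0 θ).le]; exact hB θ)

theorem integral_pos_of_pos {f : ℝ → ℝ} (h0 : ∀ θ, 0 < f θ) {π : ProbabilityMeasure ℝ}
    (hf : Integrable f (π : Measure ℝ)) : 0 < ∫ θ, f θ ∂(π : Measure ℝ) := by
  rw [integral_pos_iff_support_of_nonneg (fun θ => (h0 θ).le) hf]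
  have : Function.support f = Set.univ := Set.eq_univ_of_forall fun θ => (h0 θ).ne'
  simp [this]

/-- The product of mixtures of kernels that are dominated by their value at `0` outside a bounded
interval attains its maximum over all mixing distributions. -/
theorem exists_prod_integral_max (f : ι → ℝ → ℝ) (hf : ∀ i, Continuous (f i))
    (h0 : ∀ i θ, 0 < f i θ) {r : ℝ} (hr : 0 ≤ r) (hout : ∀ i θ, r < |θ| → f i θ ≤ f i 0) {B : ℝ}
    (hB : ∀ i θ, f i θ ≤ B) :
    ∃ πhat : ProbabilityMeasure ℝ, ∀ π : ProbabilityMeasure ℝ,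
      ∏ i, ∫ θ, f i θ ∂(π : Measure ℝ) ≤ ∏ i, ∫ θ, f i θ ∂(πhat : Measure ℝ) := by
  classical
  let K : Set ℝ := Set.Icc (-r) r
  have h0K : (0 : ℝ) ∈ K := ⟨by linarith, hr⟩
  have : CompactSpace K := isCompact_iff_compactSpace.1 isCompact_Icc
  have : Nonempty K := ⟨⟨0, h0K⟩⟩
  -- Probability measures on a compact interval form a weakly compact space, on which the objective
  -- is continuous.
  let F : ProbabilityMeasure K → ℝ := fun ρ => ∏ i, ∫ θ, f i (θ : ℝ) ∂(ρ : Measure K)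
  have hF : Continuous F := by
    refine continuous_finsetProd _ fun i _ => ?_
    exact ProbabilityMeasure.continuous_integral_boundedContinuousFunction
      (BoundedContinuousFunction.mkOfCompact ⟨fun θ : K => f i θ, by fun_prop⟩)
  have : Nonempty (ProbabilityMeasure K) := ⟨⟨Measure.dirac ⟨0, h0K⟩, inferInstance⟩⟩
  obtain ⟨ρ, -, hρ⟩ := isCompact_univ.exists_isMaxOn (Set.univ_nonempty) hF.continuousOn
  -- Moving the mass outside the interval to `0` decreases no factor, so the maximum over `K` is
  -- global.
  let T : ℝ → K := fun θ => if h : θ ∈ K then ⟨θ, h⟩ else ⟨0, h0K⟩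
  have hT : Measurable T :=
    Measurable.dite (s := K) measurable_id measurable_const measurableSet_Icc
  refine ⟨ρ.map (f := ((↑) : K → ℝ)) measurable_subtype_coe.aemeasurable, fun π => ?_⟩
  have h1 : ∀ i, ∫ θ, f i θ ∂(ρ.map (f := ((↑) : K → ℝ)) measurable_subtype_coe.aemeasurable :
      Measure ℝ) = ∫ θ, f i (θ : ℝ) ∂(ρ : Measure K) := fun i =>
    integral_map measurable_subtype_coe.aemeasurable (hf i).aestronglyMeasurable
  have h2 : ∀ i, ∫ θ, f i (θ : ℝ) ∂(π.map (f := T) hT.aemeasurable : Measure K) =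
      ∫ θ, f i (T θ : ℝ) ∂(π : Measure ℝ) := fun i =>
    integral_map hT.aemeasurable
      ((hf i).comp continuous_subtype_val).aestronglyMeasurable
  simp_rw [h1]
  refine le_trans ?_ (hρ (Set.mem_univ (π.map (f := T) hT.aemeasurable)))
  change _ ≤ ∏ i, ∫ θ, f i (θ : ℝ) ∂(π.map (f := T) hT.aemeasurable : Measure K)
  simp_rw [h2]
  refine Finset.prod_le_prod (fun i _ => integral_nonneg fun θ => (h0 i θ).le) fun i _ => ?_
  refine integral_mono (integrable_of_bounded_continuous (hf i) (h0 i) (hB i) π) ?_ fun θ => ?_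
  · refine Integrable.of_bound
      ((hf i).measurable.comp (measurable_subtype_coe.comp hT)).aestronglyMeasurable B
      (ae_of_all _ fun θ => ?_)
    rw [Real.norm_of_nonneg (h0 i _).le]
    exact hB i _
  · by_cases h : θ ∈ K
    · simp [T, h]
    · have : r < |θ| := by
        by_contra! h'
        exact h (abs_le.1 h')
      simpa [T, h] using hout i θ this

/-- The mixture `(1 - t) π + t δ_θ`. -/
noncomputable def contaminate (π : ProbabilityMeasure ℝ) (θ : ℝ) (t : Set.Icc (0 : ℝ) 1) :
    ProbabilityMeasure ℝ :=
  ⟨ENNReal.ofReal (1 - t) • (π : Measure ℝ) + ENNReal.ofReal t • Measure.dirac θ, ⟨by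
    simp [← ENNReal.ofReal_add (sub_nonneg.2 t.2.2) t.2.1]⟩⟩

theorem integral_contaminate {f : ℝ → ℝ} {π : ProbabilityMeasure ℝ}
    (hf : Integrable f (π : Measure ℝ)) (hfm : Measurable f) (θ : ℝ) (t : Set.Icc (0 : ℝ) 1) :
    ∫ x, f x ∂(contaminate π θ t : Measure ℝ) =
      (1 - t) * ∫ x, f x ∂(π : Measure ℝ) + t * f θ := by
  have hd : Integrable f (Measure.dirac θ) := by
    refine ⟨hfm.aestronglyMeasurable, ?_⟩
    simp [HasFiniteIntegral, lintegral_dirac]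
  change ∫ x, f x ∂(ENNReal.ofReal (1 - t) • (π : Measure ℝ) +
    ENNReal.ofReal t • Measure.dirac θ) = _
  rw [integral_add_measure (hf.smul_measure ENNReal.ofReal_ne_top)
    (hd.smul_measure ENNReal.ofReal_ne_top), integral_smul_measure, integral_smul_measure,
    integral_dirac, ENNReal.toReal_ofReal (sub_nonneg.2 t.2.2), ENNReal.toReal_ofReal t.2.1]
  simp

/-- The product equals `1` at `t = 0`, where its derivative is the sum; staying at most `1` to the
right forces a nonpositive derivative. -/
theorem sum_le_zero_of_prod_one_add_le_one (a : ι → ℝ)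
    (h : ∀ t ∈ Set.Ioo (0 : ℝ) 1, ∏ i, (1 + t * a i) ≤ 1) : ∑ i, a i ≤ 0 := by
  classical
  have hd : HasDerivAt (fun t : ℝ => ∏ i, (1 + t * a i)) (∑ i, a i) 0 := by
    have := HasDerivAt.fun_finsetProd (u := Finset.univ) (f := fun i (t : ℝ) => 1 + t * a i)
      (f' := a) (x := 0) fun i _ => by
        simpa using ((hasDerivAt_id (0 : ℝ)).mul_const (a i)).const_add 1
    simpa using this
  have hs := hd.tendsto_slope.mono_left (nhdsWithin_mono 0 (fun x hx => ne_of_gt hx :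
    Set.Ioi (0 : ℝ) ⊆ {0}ᶜ))
  refine le_of_tendsto hs ?_
  filter_upwards [Ioo_mem_nhdsGT (zero_lt_one (α := ℝ))] with t ht
  rw [slope_def_field]
  refine div_nonpos_of_nonpos_of_nonneg ?_ (by linarith [ht.1])
  simpa using h t ht

/-- The first-order optimality condition at a maximizer of a product of mixtures. -/
theorem sum_div_integral_le_card (f : ι → ℝ → ℝ) (hf : ∀ i, Continuous (f i))
    (h0 : ∀ i θ, 0 < f i θ) {B : ℝ} (hB : ∀ i θ, f i θ ≤ B) {πhat : ProbabilityMeasure ℝ}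
    (hmax : ∀ π : ProbabilityMeasure ℝ,
      ∏ i, ∫ θ, f i θ ∂(π : Measure ℝ) ≤ ∏ i, ∫ θ, f i θ ∂(πhat : Measure ℝ)) (θ : ℝ) :
    ∑ i, f i θ / ∫ x, f i x ∂(πhat : Measure ℝ) ≤ Fintype.card ι := by
  have hint := fun i => integrable_of_bounded_continuous (hf i) (h0 i) (hB i) πhat
  have hu := fun i => integral_pos_of_pos (h0 i) (hint i)
  have := sum_le_zero_of_prod_one_add_le_one
    (fun i => f i θ / (∫ x, f i x ∂(πhat : Measure ℝ)) - 1) fun t ht => by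
      have h := hmax (contaminate πhat θ ⟨t, ht.1.le, ht.2.le⟩)
      simp_rw [fun i => integral_contaminate (hint i) (hf i).measurable] at h
      rw [← div_le_one (Finset.prod_pos fun i _ => hu i), ← Finset.prod_div_distrib] at h
      refine le_trans (le_of_eq (Finset.prod_congr rfl fun i _ => ?_)) h
      have := (hu i).ne'
      field_simp
      ring
  simp only [Finset.sum_sub_distrib, Finset.sum_const, Finset.card_univ, nsmul_eq_mul,
    mul_one] at this
  linarith

/-- The first-order optimality condition is an equality on the support of the maximizer. -/
theorem sum_div_integral_eq_card (f : ι → ℝ → ℝ) (hf : ∀ i, Continuous (f i))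
    (h0 : ∀ i θ, 0 < f i θ) {B : ℝ} (hB : ∀ i θ, f i θ ≤ B) {πhat : ProbabilityMeasure ℝ}
    (hmax : ∀ π : ProbabilityMeasure ℝ,
      ∏ i, ∫ θ, f i θ ∂(π : Measure ℝ) ≤ ∏ i, ∫ θ, f i θ ∂(πhat : Measure ℝ)) {θ : ℝ}
    (hθ : θ ∈ (πhat : Measure ℝ).support) :
    ∑ i, f i θ / ∫ x, f i x ∂(πhat : Measure ℝ) = Fintype.card ι := by
  have hint := fun i => integrable_of_bounded_continuous (hf i) (h0 i) (hB i) πhat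
  have hu := fun i => integral_pos_of_pos (h0 i) (hint i)
  have hle := sum_div_integral_le_card f hf h0 hB hmax
  have hi : Integrable (fun θ => ∑ i, f i θ / ∫ x, f i x ∂(πhat : Measure ℝ))
      (πhat : Measure ℝ) := integrable_finsetSum _ fun i _ => (hint i).div_const _
  -- The slack is nonnegative and averages to zero under the maximizer, so it vanishes almost
  -- everywhere; by continuity its zero set is closed and hence contains the support.
  have hzero : ∫ θ, ((Fintype.card ι : ℝ) - ∑ i, f i θ / ∫ x, f i x ∂(πhat : Measure ℝ))
      ∂(πhat : Measure ℝ) = 0 := by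
    rw [integral_sub (integrable_const _) hi,
      integral_finsetSum _ fun i _ => (hint i).div_const _]
    simp_rw [integral_div, fun i => div_self (hu i).ne']
    simp
  rw [integral_eq_zero_iff_of_nonneg (fun θ => sub_nonneg.2 (hle θ))
    ((integrable_const _).sub hi)] at hzero
  have hclosed : IsClosed {θ | ∑ i, f i θ / ∫ x, f i x ∂(πhat : Measure ℝ) = Fintype.card ι} :=
    isClosed_eq (continuous_finsetSum _ fun i _ => (hf i).div_const _) continuous_const
  refine Measure.support_subset_of_isClosed hclosed ?_ hθ
  filter_upwards [hzero] with θ h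
  exact (sub_eq_zero.1 h).symm

end Maximizer

/-! ### The log-MGF of a symmetric law -/

section CGF

variable {μ : Measure ℝ}

theorem exp_cgf_id [IsProbabilityMeasure μ]
    (hint : ∀ θ : ℝ, Integrable (fun x => Real.exp (θ * x)) μ) (θ : ℝ) :
    Real.exp (cgf id μ θ) = ∫ x, Real.exp (θ * x) ∂μ :=
  exp_cgf (hint θ)

theorem mgf_id_neg (hsymm : μ.map (fun x => -x) = μ) (θ : ℝ) : mgf id μ (-θ) = mgf id μ θ := by
  conv_rhs => rw [← hsymm, mgf_id_map measurable_neg.aemeasurable]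
  rw [← mgf_neg]
  rfl

theorem cgf_id_abs (hsymm : μ.map (fun x => -x) = μ) (θ : ℝ) :
    cgf id μ |θ| = cgf id μ θ := by
  rcases abs_choice θ with h | h
  · rw [h]
  · rw [h, cgf, mgf_id_neg hsymm, cgf]

/-- By symmetry the MGF is the mean of `cosh (θ x)`, which is at least `1`. -/
theorem cgf_id_nonneg [IsProbabilityMeasure μ] (hsymm : μ.map (fun x => -x) = μ)
    (hint : ∀ θ : ℝ, Integrable (fun x => Real.exp (θ * x)) μ) (θ : ℝ) : 0 ≤ cgf id μ θ := by
  refine Real.log_nonneg ?_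
  have h1 : 2 ≤ mgf id μ θ + mgf id μ (-θ) := by
    simp only [mgf, id]
    rw [← integral_add (hint θ) (hint (-θ))]
    calc (2 : ℝ) = ∫ _, (2 : ℝ) ∂μ := by simp
      _ ≤ _ := by
        refine integral_mono (integrable_const _) ((hint θ).add (hint (-θ))) fun x => ?_
        have := Real.one_le_cosh (θ * x)
        rw [Real.cosh_eq] at this
        simp only [neg_mul]
        linarith
  rw [mgf_id_neg hsymm] at h1
  linarith

/-- The log-MGF divided by its argument is nondecreasing. -/
theorem cgf_id_le_div_mul [IsProbabilityMeasure μ]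
    (hint : ∀ θ : ℝ, Integrable (fun x => Real.exp (θ * x)) μ)
    {r θ : ℝ} (hr : 0 ≤ r) (hrθ : r ≤ θ) (hθ : 0 < θ) :
    cgf id μ r ≤ r / θ * cgf id μ θ := by
  have hp0 : 0 ≤ r / θ := by positivity
  have hp1 : r / θ ≤ 1 := (div_le_one hθ).2 hrθ
  -- Jensen's inequality for the concave power `y ^ (r / θ)` applied to `exp (θ x)`.
  have hpow : ∀ x : ℝ, Real.exp (θ * x) ^ (r / θ) = Real.exp (r * x) := fun x => by
    rw [← Real.exp_mul]
    congr 1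
    field_simp
  have h := (Real.concaveOn_rpow hp0 hp1).le_map_integral (μ := μ)
    (f := fun x => Real.exp (θ * x)) (Real.continuous_rpow_const hp0).continuousOn isClosed_Ici
    (ae_of_all _ fun x => (Real.exp_pos _).le) (hint θ)
    (by simpa only [Function.comp_def, hpow] using hint r)
  simp only [hpow] at h
  rw [← exp_cgf_id hint, ← exp_cgf_id hint, ← Real.exp_mul, Real.exp_le_exp] at h
  linarith

theorem cgf_id_mono [IsProbabilityMeasure μ] (hsymm : μ.map (fun x => -x) = μ)
    (hint : ∀ θ : ℝ, Integrable (fun x => Real.exp (θ * x)) μ) {r θ : ℝ} (h : |r| ≤ |θ|) :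
    cgf id μ r ≤ cgf id μ θ := by
  rw [← cgf_id_abs hsymm r, ← cgf_id_abs hsymm θ]
  rcases (abs_nonneg θ).eq_or_lt with h0 | h0
  · rw [← h0] at h ⊢
    rw [le_antisymm h (abs_nonneg r)]
  · refine (cgf_id_le_div_mul hint (abs_nonneg r) h h0).trans ?_
    exact mul_le_of_le_one_left (cgf_id_nonneg hsymm hint _) ((div_le_one h0).2 h)

theorem continuous_cgf_id [IsProbabilityMeasure μ]
    (hint : ∀ θ : ℝ, Integrable (fun x => Real.exp (θ * x)) μ) :
    Continuous (cgf id μ) :=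
  (continuous_mgf (X := id) hint).log fun θ => (mgf_pos (hint θ)).ne'

/-- If `κ r` exceeds `r t` by `log 2`, then `κ` lies strictly above the cone of slope `t`
outside `(-r, r)`. -/
theorem abs_mul_lt_cgf_id [IsProbabilityMeasure μ] (hsymm : μ.map (fun x => -x) = μ)
    (hint : ∀ θ : ℝ, Integrable (fun x => Real.exp (θ * x)) μ) {r t : ℝ} (hr : 0 < r)
    (hrt : r * t + Real.log 2 ≤ cgf id μ r) {θ : ℝ} (hθ : r ≤ |θ|) :
    |θ| * t < cgf id μ θ := by
  have hθ0 : 0 < |θ| := hr.trans_le hθ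
  have h := cgf_id_le_div_mul hint hr.le hθ hθ0
  rw [cgf_id_abs hsymm, div_mul_eq_mul_div, le_div_iff₀ hθ0] at h
  have h2 : 0 < Real.log 2 := Real.log_pos one_lt_two
  have h3 : r * (|θ| * t) < r * cgf id μ θ := by
    have : (r * t + Real.log 2) * |θ| ≤ cgf id μ r * |θ| := by gcongr
    nlinarith [mul_pos h2 hθ0]
  exact lt_of_mul_lt_mul_left h3 hr.le

theorem differentiable_complexMGF_id
    (hint : ∀ θ : ℝ, Integrable (fun x => Real.exp (θ * x)) μ) :
    Differentiable ℂ (complexMGF id μ) := by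
  have h : integrableExpSet id μ = Set.univ := Set.eq_univ_of_forall hint
  rw [← differentiableOn_univ]
  simpa [h] using differentiableOn_complexMGF (X := id) (μ := μ)

end CGF

/-! ### Reduction of the likelihood to a product of integrals -/

section Likelihood

variable {ν : Measure ℝ} {p₀ : ℝ → ℝ≥0}

theorem mixDensity_eq {π : ProbabilityMeasure ℝ} {x : ℝ}
    (hint : Integrable (fun θ => Real.exp (θ * x - logMGF ν p₀ θ)) (π : Measure ℝ)) :
    mixDensity ν p₀ π x =
      ENNReal.ofReal (∫ θ, Real.exp (θ * x - logMGF ν p₀ θ) ∂(π : Measure ℝ)) * p₀ x := by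
  rw [mixDensity]
  simp only [density]
  rw [lintegral_mul_const'' _ hint.aemeasurable.ennreal_ofReal,
    ofReal_integral_eq_lintegral_ofReal hint (ae_of_all _ fun θ => (Real.exp_pos _).le)]

theorem sum_ennrealLog_eq {ι : Type*} (s : Finset ι) (f : ι → ℝ≥0∞) :
    ∑ i ∈ s, ENNReal.log (f i) = ENNReal.log (∏ i ∈ s, f i) := by
  classical
  induction s using Finset.induction_on with
  | empty => simp
  | insert a s ha ih => rw [Finset.sum_insert ha, Finset.prod_insert ha, ENNReal.log_mul_add, ih]

theorem logLik_le_iff {n : ℕ} (hn : 0 < n) (x : Fin n → ℝ) (π π' : ProbabilityMeasure ℝ) :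
    logLik ν p₀ x π ≤ logLik ν p₀ x π' ↔
      ∏ i, mixDensity ν p₀ π (x i) ≤ ∏ i, mixDensity ν p₀ π' (x i) := by
  have hn' : (0 : ℝ) < n := by exact_mod_cast hn
  simp only [logLik, sum_ennrealLog_eq]
  rw [← ENNReal.log_le_log_iff]
  refine ⟨fun h => ?_, fun h => mul_le_mul_of_nonneg_left h (by
    exact_mod_cast (inv_pos.2 hn').le)⟩
  have h2 := mul_le_mul_of_nonneg_left h (show (0 : EReal) ≤ ((n : ℝ) : EReal) by
    exact_mod_cast hn'.le)
  rwa [← mul_assoc, ← mul_assoc, ← EReal.coe_mul, mul_inv_cancel₀ hn'.ne', EReal.coe_one,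
    one_mul, one_mul] at h2

/-- The common factor `∏ i, p₀ (x i)` is positive and finite, so it cancels. -/
theorem isNPMLE_iff {n : ℕ} (hn : 0 < n) (x : Fin n → ℝ) (hx : ∀ i, p₀ (x i) ≠ 0)
    (hint : ∀ (π : ProbabilityMeasure ℝ) (i : Fin n),
      Integrable (fun θ => Real.exp (θ * x i - logMGF ν p₀ θ)) (π : Measure ℝ))
    (πhat : ProbabilityMeasure ℝ) :
    IsNPMLE ν p₀ x πhat ↔ ∀ π : ProbabilityMeasure ℝ,
      ∏ i, ∫ θ, Real.exp (θ * x i - logMGF ν p₀ θ) ∂(π : Measure ℝ) ≤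
        ∏ i, ∫ θ, Real.exp (θ * x i - logMGF ν p₀ θ) ∂(πhat : Measure ℝ) := by
  have hpos : ∀ (π : ProbabilityMeasure ℝ) (i : Fin n),
      0 ≤ ∫ θ, Real.exp (θ * x i - logMGF ν p₀ θ) ∂(π : Measure ℝ) := fun π i =>
    integral_nonneg fun θ => (Real.exp_pos _).le
  refine forall_congr' fun π => ?_
  rw [logLik_le_iff hn]
  simp_rw [fun π i => mixDensity_eq (hint π i)]
  rw [Finset.prod_mul_distrib, Finset.prod_mul_distrib,
    ← ENNReal.ofReal_prod_of_nonneg fun i _ => hpos π i,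
    ← ENNReal.ofReal_prod_of_nonneg fun i _ => hpos πhat i,
    ENNReal.mul_le_mul_iff_left
      (Finset.prod_ne_zero_iff.2 fun i _ => ENNReal.coe_ne_zero.2 (hx i))
      (ENNReal.prod_ne_top fun i _ => ENNReal.coe_ne_top),
    ENNReal.ofReal_le_ofReal_iff (Finset.prod_nonneg fun i _ => hpos πhat i)]

end Likelihood

/-! ### Bounded data: atoms as zeros of an entire function -/

section Deterministic

variable {μ : Measure ℝ} [IsProbabilityMeasure μ]

theorem exp_sub_cgf_le_one (hsymm : μ.map (fun x => -x) = μ)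
    (hint : ∀ θ : ℝ, Integrable (fun x => Real.exp (θ * x)) μ) {r t : ℝ} (hr : 0 < r)
    (hrt : r * t + Real.log 2 ≤ cgf id μ r) {x : ℝ} (hx : |x| ≤ t) {θ : ℝ} (hθ : r ≤ |θ|) :
    Real.exp (θ * x - cgf id μ θ) ≤ 1 := by
  rw [Real.exp_le_one_iff]
  have h1 := abs_mul_lt_cgf_id hsymm hint hr hrt hθ
  have h2 : θ * x ≤ |θ| * t := (le_abs_self _).trans (by rw [abs_mul]; gcongr)
  linarith

theorem exp_sub_cgf_le (hsymm : μ.map (fun x => -x) = μ)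
    (hint : ∀ θ : ℝ, Integrable (fun x => Real.exp (θ * x)) μ) {r t : ℝ} (hr : 0 < r)
    (hrt : r * t + Real.log 2 ≤ cgf id μ r) {x : ℝ} (hx : |x| ≤ t) (θ : ℝ) :
    Real.exp (θ * x - cgf id μ θ) ≤ Real.exp (r * t) := by
  have ht : 0 ≤ t := (abs_nonneg x).trans hx
  rcases le_total r |θ| with h | h
  · exact (exp_sub_cgf_le_one hsymm hint hr hrt hx h).trans (Real.one_le_exp (by positivity))
  · have h1 := cgf_id_nonneg hsymm hint θ
    have h2 : θ * x ≤ r * t := (le_abs_self _).trans (by rw [abs_mul]; gcongr)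
    exact Real.exp_le_exp.2 (by linarith)

/-- An average of exponentials of total weight at most one. -/
theorem weighted_exp_sum_le {ι : Type*} [Fintype ι] {w x : ι → ℝ} (hw : ∀ i, 0 ≤ w i)
    (hsum : ∑ i, w i ≤ 1) {t : ℝ} (hx : ∀ i, |x i| ≤ t) (θ : ℝ) :
    ∑ i, w i * Real.exp (θ * x i) ≤ Real.exp (|θ| * t) := by
  calc ∑ i, w i * Real.exp (θ * x i) ≤ ∑ i, w i * Real.exp (|θ| * t) := by
        refine Finset.sum_le_sum fun i _ => mul_le_mul_of_nonneg_left ?_ (hw i)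
        refine Real.exp_le_exp.2 ((le_abs_self _).trans ?_)
        rw [abs_mul]
        gcongr
        exact hx i
    _ = (∑ i, w i) * Real.exp (|θ| * t) := by rw [Finset.sum_mul]
    _ ≤ _ := mul_le_of_le_one_left (Real.exp_pos _).le hsum

/-- The number of points at which the moment generating function agrees with a weighted sum of
exponentials of total weight at most one. -/
theorem card_mgf_eq_sum_exp_le (hsymm : μ.map (fun x => -x) = μ)
    (hint : ∀ θ : ℝ, Integrable (fun x => Real.exp (θ * x)) μ) {r t : ℝ} (hr : 0 < r)
    (hrt : r * t + Real.log 2 ≤ cgf id μ r) {ι : Type*} [Fintype ι] [Nonempty ι]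
    {w x : ι → ℝ} (hw : ∀ i, 0 ≤ w i) (hsum : ∑ i, w i ≤ 1) (hx : ∀ i, |x i| ≤ t) (s : Finset ℝ)
    (hs : ∀ θ ∈ s, ∑ i, w i * Real.exp (θ * x i) = mgf id μ θ) :
    s.card * Real.log 2 ≤ 2 * Real.log 2 + cgf id μ (8 * r) := by
  classical
  have hmgf : ∀ θ, mgf id μ θ = Real.exp (cgf id μ θ) := fun θ => (exp_cgf (hint θ)).symm
  have hF := weighted_exp_sum_le hw hsum hx
  -- Outside `(-r, r)` the exponential sum is at most `exp (|θ| t)`, strictly below the MGF.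
  have hsr : ∀ θ ∈ s, |θ| < r := fun θ hθ => by
    by_contra! h
    have h1 := abs_mul_lt_cgf_id hsymm hint hr hrt h
    have h2 := hF θ
    rw [hs θ hθ, hmgf, Real.exp_le_exp] at h2
    linarith
  let F : ℂ → ℂ := fun z => ∑ i, (w i : ℂ) * Complex.exp (z * x i)
  let h : ℂ → ℂ := fun z => complexMGF id μ z - F z
  have hd : Differentiable ℂ h :=
    (differentiable_complexMGF_id hint).sub (by fun_prop)
  have hFr : ∀ θ : ℝ, F θ = ((∑ i, w i * Real.exp (θ * x i) : ℝ) : ℂ) := fun θ => by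
    simp [F]
  have hreal : ∀ θ : ℝ, h θ = ((mgf id μ θ - ∑ i, w i * Real.exp (θ * x i) : ℝ) : ℂ) :=
    fun θ => by simp only [h, hFr, complexMGF_ofReal]; push_cast; rfl
  -- The sphere of radius `6 * r` about `r` lies in `‖z‖ ≤ 7 * r`. Rounding `7` up to `8 = 2 ^ 3`
  -- suits the doubling condition.
  have hnorm : ∀ z : ℂ, ‖z - r‖ = 3 * (2 * r) → ‖h z‖ ≤ 2 * Real.exp (cgf id μ (8 * r)) := by
    intro z hz
    have hzn : ‖z‖ ≤ 7 * r := by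
      have := norm_add_le (z - r) (r : ℂ)
      rw [sub_add_cancel, hz, Complex.norm_real, Real.norm_of_nonneg hr.le] at this
      linarith
    have hre : |z.re| ≤ 7 * r := (Complex.abs_re_le_norm z).trans hzn
    have hle : ∀ y : ℝ, |y| ≤ 7 * r → cgf id μ y ≤ cgf id μ (8 * r) := fun y hy => by
      refine cgf_id_mono hsymm hint ?_
      rw [abs_of_pos (by positivity : 0 < 8 * r)]
      linarith
    have h1 : ‖complexMGF id μ z‖ ≤ Real.exp (cgf id μ (8 * r)) := by
      refine norm_complexMGF_le_mgf.trans ?_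
      rw [hmgf, Real.exp_le_exp]
      exact hle _ hre
    have h2 : ‖F z‖ ≤ Real.exp (cgf id μ (8 * r)) := by
      have h3 : ‖F z‖ ≤ ∑ i, w i * Real.exp (z.re * x i) := by
        refine (norm_sum_le _ _).trans (le_of_eq (Finset.sum_congr rfl fun i _ => ?_))
        rw [norm_mul, Complex.norm_real, Real.norm_of_nonneg (hw i), Complex.norm_exp]
        simp
      refine (h3.trans (hF _)).trans (Real.exp_le_exp.2 ?_)
      have ht : 0 ≤ t := (abs_nonneg _).trans (hx (Classical.arbitrary ι))
      have h7 := abs_mul_lt_cgf_id hsymm hint hr hrt (θ := 7 * r)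
        (by rw [abs_of_pos (by positivity)]; linarith)
      rw [abs_of_pos (by positivity)] at h7
      have h8 := hle (7 * r) (by rw [abs_of_pos (by positivity)])
      have h9 : |z.re| * t ≤ 7 * r * t := by gcongr
      linarith
    exact (norm_sub_le _ _).trans (by linarith)
  -- The margin `log 2` makes the MGF at `r` at least twice the exponential sum, and the MGF is at
  -- least `1`.
  have hcenter : 1 / 2 ≤ ‖h r‖ := by
    rw [hreal, Complex.norm_real]
    refine le_trans ?_ (le_abs_self _)
    have h1 := hF r
    rw [abs_of_pos hr] at h1
    have h2 : Real.exp (r * t) * 2 ≤ Real.exp (cgf id μ r) := by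
      have h4 := Real.exp_le_exp.2 hrt
      rwa [Real.exp_add, Real.exp_log zero_lt_two] at h4
    have h3 := Real.one_le_exp (cgf_id_nonneg hsymm hint r)
    rw [hmgf]
    linarith
  -- The disc of radius `2 * r` about `r` contains the whole interval `(-r, r)`.
  have hcount := two_pow_card_zeros_mul_le hd (c := (r : ℂ)) (ρ := 2 * r) (by positivity) hnorm
    (s.image ((↑) : ℝ → ℂ))
    (by
      simp only [Finset.mem_image, forall_exists_index, and_imp, forall_apply_eq_imp_iff₂]
      intro θ hθ
      rw [hreal, hs θ hθ, sub_self, Complex.ofReal_zero])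
    (by
      simp only [Finset.mem_image, forall_exists_index, and_imp, forall_apply_eq_imp_iff₂]
      intro θ hθ
      rw [← Complex.ofReal_sub, Complex.norm_real]
      refine (abs_sub _ _).trans ?_
      rw [abs_of_pos hr]
      linarith [hsr θ hθ])
  rw [Finset.card_image_of_injective _ Complex.ofReal_injective] at hcount
  have h4 : (2 : ℝ) ^ s.card ≤ 4 * Real.exp (cgf id μ (8 * r)) := by
    have : (2 : ℝ) ^ s.card * (1 / 2) ≤ 2 ^ s.card * ‖h r‖ := by gcongr
    linarith
  have h5 := Real.log_le_log (by positivity) h4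
  rw [Real.log_pow, Real.log_mul (by norm_num) (Real.exp_pos _).ne', Real.log_exp,
    show (4 : ℝ) = 2 ^ 2 by norm_num, Real.log_pow] at h5
  simpa using h5

end Deterministic

/-- On bounded data, an NPMLE exists, and the number of atoms of every NPMLE is controlled by the
log-MGF. -/
theorem exists_isNPMLE_and_atoms_le {ν : Measure ℝ} {p₀ : ℝ → ℝ≥0}
    [IsProbabilityMeasure (baseLaw ν p₀)]
    (hsymm : (baseLaw ν p₀).map (fun x => -x) = baseLaw ν p₀)
    (hint : ∀ θ : ℝ, Integrable (fun x => Real.exp (θ * x)) (baseLaw ν p₀)) {r t : ℝ}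
    (hr : 0 < r) (hrt : r * t + Real.log 2 ≤ logMGF ν p₀ r) {n : ℕ} (hn : 0 < n) {x : Fin n → ℝ}
    (hx : ∀ i, |x i| ≤ t) (hp : ∀ i, p₀ (x i) ≠ 0) {m : ℝ}
    (hm : 2 * Real.log 2 + logMGF ν p₀ (8 * r) ≤ m * Real.log 2) :
    (∃ πhat, IsNPMLE ν p₀ x πhat) ∧
      ∀ πhat, IsNPMLE ν p₀ x πhat → AtMostAtoms πhat m := by
  have hκ : ∀ θ, logMGF ν p₀ θ = cgf id (baseLaw ν p₀) θ := fun θ => rfl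
  let f : Fin n → ℝ → ℝ := fun i θ => Real.exp (θ * x i - logMGF ν p₀ θ)
  have hcont : Continuous (logMGF ν p₀) := continuous_cgf_id hint
  have hf : ∀ i, Continuous (f i) := fun i => by fun_prop
  have hf0 : ∀ i θ, 0 < f i θ := fun i θ => Real.exp_pos _
  have hB : ∀ i θ, f i θ ≤ Real.exp (r * t) := fun i θ =>
    exp_sub_cgf_le hsymm hint hr hrt (hx i) θ
  have hout : ∀ i θ, r < |θ| → f i θ ≤ f i 0 := fun i θ hθ => by
    refine (exp_sub_cgf_le_one hsymm hint hr hrt (hx i) hθ.le).trans (le_of_eq ?_)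
    simp [f, hκ]
  have hfi : ∀ (π : ProbabilityMeasure ℝ) i, Integrable (f i) (π : Measure ℝ) := fun π i =>
    integrable_of_bounded_continuous (hf i) (hf0 i) (hB i) π
  have hiff := isNPMLE_iff hn x hp hfi
  refine ⟨?_, fun πhat hπ => ?_⟩
  · obtain ⟨πhat, h⟩ := exists_prod_integral_max f hf hf0 hr.le hout hB
    exact ⟨πhat, (hiff πhat).2 h⟩
  have : Nonempty (Fin n) := ⟨⟨0, hn⟩⟩
  have hmax := (hiff πhat).1 hπ
  let u : Fin n → ℝ := fun i => ∫ θ, f i θ ∂(πhat : Measure ℝ)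
  have hu : ∀ i, 0 < u i := fun i => integral_pos_of_pos (hf0 i) (hfi πhat i)
  have hn' : (0 : ℝ) < n := by exact_mod_cast hn
  let w : Fin n → ℝ := fun i => (n * u i)⁻¹
  have hw : ∀ i, 0 ≤ w i := fun i => inv_nonneg.2 (mul_nonneg hn'.le (hu i).le)
  have hwf : ∀ θ, ∑ i, w i * Real.exp (θ * x i) =
      (∑ i, f i θ / u i) / n * mgf id (baseLaw ν p₀) θ := fun θ => by
    rw [Finset.sum_div, Finset.sum_mul]
    refine Finset.sum_congr rfl fun i _ => ?_
    have h1 := (hu i).ne'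
    simp only [w, f]
    rw [Real.exp_sub, hκ, exp_cgf (X := id) (hint θ)]
    have h2 := (mgf_pos (X := id) (hint θ)).ne'
    field_simp
  -- The total weight is the first-order inequality read at `θ = 0`, where the MGF equals `1`.
  have hsum : ∑ i, w i ≤ 1 := by
    have h1 := hwf 0
    simp only [zero_mul, Real.exp_zero, mul_one, mgf_zero] at h1
    rw [h1, div_le_one hn']
    simpa using sum_div_integral_le_card f hf hf0 hB hmax 0
  have hcard : ∀ s : Finset ℝ, (s : Set ℝ) ⊆ (πhat : Measure ℝ).support → (s.card : ℝ) ≤ m := by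
    intro s hs
    have h1 := card_mgf_eq_sum_exp_le hsymm hint hr hrt hw hsum hx s fun θ hθ => by
      have h2 := sum_div_integral_eq_card f hf hf0 hB hmax (hs hθ)
      rw [hwf, h2, Fintype.card_fin, div_self hn'.ne', one_mul]
    exact le_of_mul_le_mul_right (h1.trans hm) (Real.log_pos one_lt_two)
  have hfin : (πhat : Measure ℝ).support.Finite := by
    by_contra hinf
    obtain ⟨s, hs, hcs⟩ := Set.Infinite.exists_subset_card_eq hinf (⌊m⌋₊ + 1)
    have h1 := hcard s hs
    rw [hcs] at h1
    push_cast at h1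
    linarith [Nat.lt_floor_add_one m]
  refine ⟨hfin, ?_⟩
  rw [Set.ncard_eq_toFinset_card _ hfin]
  exact hcard _ (by simp)

/-! ### Tail bounds for the sample -/

section Tail

variable {ν : Measure ℝ} {p₀ : ℝ → ℝ≥0}

theorem measurable_density (hp₀ : Measurable p₀)
    (hcont : Continuous (logMGF ν p₀)) : Measurable (Function.uncurry (density ν p₀)) := by
  have h1 : Measurable fun q : ℝ × ℝ => Real.exp (q.1 * q.2 - logMGF ν p₀ q.1) := by
    have := hcont.measurable
    fun_prop
  have h2 : Measurable fun q : ℝ × ℝ => (p₀ q.2 : ℝ≥0∞) :=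
    (hp₀.comp measurable_snd).coe_nnreal_ennreal
  exact h1.ennreal_ofReal.mul h2

theorem setLIntegral_density_le [IsProbabilityMeasure (baseLaw ν p₀)] (hp₀ : Measurable p₀)
    (hsymm : (baseLaw ν p₀).map (fun x => -x) = baseLaw ν p₀)
    (hint : ∀ θ : ℝ, Integrable (fun x => Real.exp (θ * x)) (baseLaw ν p₀)) {b s t θ : ℝ}
    (hs : 0 ≤ s) (hθ : |θ| ≤ b) :
    ∫⁻ x in {x | t < |x|}, density ν p₀ θ x ∂ν ≤
      ENNReal.ofReal (2 * Real.exp (logMGF ν p₀ (s + b) - s * t)) := by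
  have hA : MeasurableSet {x : ℝ | t < |x|} := measurableSet_lt measurable_const (by fun_prop)
  have hexp : ∀ y, |y| ≤ s + b →
      ∫ x, Real.exp (y * x) ∂(baseLaw ν p₀) ≤ Real.exp (logMGF ν p₀ (s + b)) := fun y hy => by
    rw [← exp_cgf_id hint, Real.exp_le_exp]
    exact cgf_id_mono hsymm hint (hy.trans (le_abs_self _))
  have hi : Integrable (fun x => Real.exp (-(s * t)) *
      (Real.exp ((θ + s) * x) + Real.exp ((θ - s) * x))) (baseLaw ν p₀) :=
    ((hint _).add (hint _)).const_mul _
  calc ∫⁻ x in {x | t < |x|}, density ν p₀ θ x ∂ν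
      = ∫⁻ x in {x | t < |x|}, ENNReal.ofReal (Real.exp (θ * x - logMGF ν p₀ θ))
          ∂(baseLaw ν p₀) := by
        rw [baseLaw, setLIntegral_withDensity_eq_setLIntegral_mul ν
          hp₀.coe_nnreal_ennreal (by fun_prop) hA]
        refine lintegral_congr fun x => ?_
        rw [density, Pi.mul_apply, mul_comm]
    _ ≤ ∫⁻ x in {x | t < |x|}, ENNReal.ofReal (Real.exp (-(s * t)) *
          (Real.exp ((θ + s) * x) + Real.exp ((θ - s) * x))) ∂(baseLaw ν p₀) := by
        -- On `t < |x|` the factor `exp (s * |x| - s * t)` exceeds `1`, and `exp (s * |x|)` is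
        -- bounded by `exp (s * x) + exp (-(s * x))`.
        refine setLIntegral_mono' hA fun x hx => ENNReal.ofReal_le_ofReal ?_
        have hκ := cgf_id_nonneg hsymm hint θ
        rw [mul_add, ← Real.exp_add, ← Real.exp_add]
        have hx' : t < |x| := hx
        have hstx : s * t ≤ s * |x| := by gcongr
        rcases abs_choice x with h | h
        · rw [h] at hstx
          refine le_trans (Real.exp_le_exp.2 ?_) (le_add_of_nonneg_right (Real.exp_pos _).le)
          change _ - cgf id (baseLaw ν p₀) θ ≤ _
          linarith
        · rw [h] at hstx
          refine le_trans (Real.exp_le_exp.2 ?_) (le_add_of_nonneg_left (Real.exp_pos _).le)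
          change _ - cgf id (baseLaw ν p₀) θ ≤ _
          linarith
    _ ≤ ∫⁻ x, ENNReal.ofReal (Real.exp (-(s * t)) *
          (Real.exp ((θ + s) * x) + Real.exp ((θ - s) * x))) ∂(baseLaw ν p₀) :=
        setLIntegral_le_lintegral _ _
    _ = ENNReal.ofReal (∫ x, Real.exp (-(s * t)) *
          (Real.exp ((θ + s) * x) + Real.exp ((θ - s) * x)) ∂(baseLaw ν p₀)) :=
        (ofReal_integral_eq_lintegral_ofReal hi (ae_of_all _ fun x => by positivity)).symm
    _ ≤ _ := by
        refine ENNReal.ofReal_le_ofReal ?_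
        rw [integral_const_mul, integral_add (hint _) (hint _),
          sub_eq_add_neg (logMGF ν p₀ (s + b)), Real.exp_add]
        have h1 := hexp (θ + s) ((abs_add_le _ _).trans (by rw [abs_of_nonneg hs]; linarith))
        have h2 := hexp (θ - s) ((abs_sub _ _).trans (by rw [abs_of_nonneg hs]; linarith))
        nlinarith [Real.exp_pos (-(s * t))]

/-- Chernoff bound for a mixture with compactly supported mixing distribution. -/
theorem mixLaw_abs_gt_le [SFinite ν] [IsProbabilityMeasure (baseLaw ν p₀)]
    (hp₀ : Measurable p₀) (hsymm : (baseLaw ν p₀).map (fun x => -x) = baseLaw ν p₀)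
    (hint : ∀ θ : ℝ, Integrable (fun x => Real.exp (θ * x)) (baseLaw ν p₀)) {b s t : ℝ}
    (hs : 0 ≤ s) {π : ProbabilityMeasure ℝ} (hπ : (π : Measure ℝ) (Set.Icc (-b) b) = 1) :
    mixLaw ν p₀ π {x | t < |x|} ≤
      ENNReal.ofReal (2 * Real.exp (logMGF ν p₀ (s + b) - s * t)) := by
  have hA : MeasurableSet {x : ℝ | t < |x|} := measurableSet_lt measurable_const (by fun_prop)
  have hmeas := measurable_density hp₀ (continuous_cgf_id hint)
  have hae : ∀ᵐ θ ∂(π : Measure ℝ), |θ| ≤ b := by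
    have h := (prob_compl_eq_zero_iff (μ := (π : Measure ℝ)) measurableSet_Icc).2 hπ
    filter_upwards [compl_mem_ae_iff.2 h] with θ hθ
    rw [compl_compl] at hθ
    exact abs_le.2 hθ
  rw [mixLaw, withDensity_apply _ hA]
  simp only [mixDensity]
  rw [lintegral_lintegral_swap (f := fun x θ => density ν p₀ θ x)
    (hmeas.comp measurable_swap).aemeasurable]
  calc _ ≤ ∫⁻ _, ENNReal.ofReal (2 * Real.exp (logMGF ν p₀ (s + b) - s * t))
        ∂(π : Measure ℝ) := by
        refine lintegral_mono_ae ?_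
        filter_upwards [hae] with θ hθ
        exact setLIntegral_density_le hp₀ hsymm hint hs hθ
    _ = _ := by simp

theorem mixLaw_density_eq_zero (hp₀ : Measurable p₀) (π : ProbabilityMeasure ℝ) :
    mixLaw ν p₀ π {x | p₀ x = 0} = 0 := by
  have hA : MeasurableSet {x | p₀ x = 0} := measurableSet_eq_fun hp₀ measurable_const
  rw [mixLaw, withDensity_apply _ hA]
  refine (setLIntegral_congr_fun hA fun x hx => ?_).trans lintegral_zero
  have hx' : p₀ x = 0 := hx
  simp [mixDensity, density, hx']

/-- A sample from the mixture is bounded by `t` and charged by the base density, outside an event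
controlled by the union bound. -/
theorem measure_exists_abs_gt_or_le [SFinite ν] [IsProbabilityMeasure (baseLaw ν p₀)]
    (hp₀ : Measurable p₀) (hsymm : (baseLaw ν p₀).map (fun x => -x) = baseLaw ν p₀)
    (hint : ∀ θ : ℝ, Integrable (fun x => Real.exp (θ * x)) (baseLaw ν p₀)) {b s t : ℝ}
    (hs : 0 ≤ s) {π : ProbabilityMeasure ℝ} (hπ : (π : Measure ℝ) (Set.Icc (-b) b) = 1) {n : ℕ}
    {Ω : Type*} [MeasurableSpace Ω] {P : Measure Ω} {X : Fin n → Ω → ℝ}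
    (hX : ∀ i, HasLaw (X i) (mixLaw ν p₀ π) P) :
    P {ω | ∃ i, t < |X i ω| ∨ p₀ (X i ω) = 0} ≤
      ENNReal.ofReal (n * (2 * Real.exp (logMGF ν p₀ (s + b) - s * t))) := by
  have hA : MeasurableSet {x : ℝ | t < |x|} := measurableSet_lt measurable_const (by fun_prop)
  have hZ : MeasurableSet {x | p₀ x = 0} := measurableSet_eq_fun hp₀ measurable_const
  have hi : ∀ i, P {ω | t < |X i ω| ∨ p₀ (X i ω) = 0} ≤
      ENNReal.ofReal (2 * Real.exp (logMGF ν p₀ (s + b) - s * t)) := fun i => by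
    have h := (hX i).measure_eq (p := fun x => t < |x| ∨ p₀ x = 0) (hA.union hZ)
    rw [h]
    refine (measure_union_le {x | t < |x|} {x | p₀ x = 0}).trans ?_
    rw [mixLaw_density_eq_zero hp₀, add_zero]
    exact mixLaw_abs_gt_le hp₀ hsymm hint hs hπ
  rw [Set.ofPred_exists]
  refine (measure_iUnion_fintype_le P _).trans ((Finset.sum_le_sum fun i _ => hi i).trans ?_)
  rw [ENNReal.ofReal_mul (Nat.cast_nonneg n), ENNReal.ofReal_natCast]
  simp

end Tail

/-! ### Iterating the doubling condition -/

section Growth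

theorem pow_growth {κ : ℝ → ℝ} {K₀ K₁ θ₀ : ℝ} (hK₀ : 0 ≤ K₀) (hK₁ : 0 ≤ K₁) (hθ₀ : 0 ≤ θ₀)
    (h : ∀ θ, θ₀ ≤ θ → K₀ * κ θ ≤ κ (2 * θ) ∧ κ (2 * θ) ≤ K₁ * κ θ) {θ : ℝ} (hθ : θ₀ ≤ θ)
    (k : ℕ) : K₀ ^ k * κ θ ≤ κ (2 ^ k * θ) ∧ κ (2 ^ k * θ) ≤ K₁ ^ k * κ θ := by
  induction k with
  | zero => simp
  | succ k ih =>
    have h1 : θ₀ ≤ 2 ^ k * θ :=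
      hθ.trans (le_mul_of_one_le_left (hθ₀.trans hθ) (one_le_pow₀ one_le_two))
    have h2 := h _ h1
    rw [pow_succ' 2, mul_assoc, pow_succ' K₀, mul_assoc, pow_succ' K₁, mul_assoc]
    exact ⟨(mul_le_mul_of_nonneg_left ih.1 hK₀).trans h2.1,
      h2.2.trans (mul_le_mul_of_nonneg_left ih.2 hK₁)⟩

/-- Limits from the right extend the condition to the endpoint `θ₀`, where the value `v` is
prescribed. -/
theorem growth_of_continuous {κ : ℝ → ℝ} (hκ : Continuous κ) {K₀ K₁ θ₀ : ℝ}
    (h : ∀ θ, θ₀ < |θ| → K₀ * κ θ ≤ κ (2 * θ) ∧ κ (2 * θ) ≤ K₁ * κ θ) {θ : ℝ} (hθ : θ₀ ≤ θ) :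
    K₀ * κ θ ≤ κ (2 * θ) ∧ κ (2 * θ) ≤ K₁ * κ θ := by
  have hev : ∀ᶠ y in 𝓝[>] θ, θ₀ < |y| := by
    filter_upwards [self_mem_nhdsWithin] with y hy
    exact (hθ.trans_lt hy).trans_le (le_abs_self y)
  have hc : Tendsto κ (𝓝[>] θ) (𝓝 (κ θ)) := hκ.continuousWithinAt
  have hc2 : Tendsto (fun y => κ (2 * y)) (𝓝[>] θ) (𝓝 (κ (2 * θ))) :=
    (hκ.comp (continuous_const.mul continuous_id)).continuousWithinAt
  exact ⟨le_of_tendsto_of_tendsto (hc.const_mul K₀) hc2 (hev.mono fun y hy => (h y hy).1),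
    le_of_tendsto_of_tendsto hc2 (hc.const_mul K₁) (hev.mono fun y hy => (h y hy).2)⟩

end Growth

end ExpFamily

/-! ### Choice of scales and conclusion -/

theorem theorem3 (K₀ K₁ b β : ℝ) (hK₀ : 2 < K₀) (hK₁ : K₀ ≤ K₁) (hb : 0 < b) (hβ : 0 < β) :
    ∃ C : ℝ, 0 < C ∧
      -- `n₀` depends on the base density only through `θ₀` and the value `v = κ(θ₀)`
      ∀ θ₀ : ℝ, 0 < θ₀ → ∀ v : ℝ, 0 < v → ∃ n₀ : ℕ,
        ∀ (ν : Measure ℝ) [SigmaFinite ν] (p₀ : ℝ → ℝ≥0), Measurable p₀ →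
          IsProbabilityMeasure (ExpFamily.baseLaw ν p₀) →
          -- symmetry around zero
          (ExpFamily.baseLaw ν p₀).map (fun x => -x) = ExpFamily.baseLaw ν p₀ →
          -- the moment generating function is finite
          (∀ θ : ℝ, Integrable (fun x => Real.exp (θ * x)) (ExpFamily.baseLaw ν p₀)) →
          -- the growth condition
          (∀ θ : ℝ, θ₀ < |θ| →
            K₀ * ExpFamily.logMGF ν p₀ θ ≤ ExpFamily.logMGF ν p₀ (2 * θ) ∧
            ExpFamily.logMGF ν p₀ (2 * θ) ≤ K₁ * ExpFamily.logMGF ν p₀ θ) →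
          ExpFamily.logMGF ν p₀ θ₀ = v →
          ∀ π : ProbabilityMeasure ℝ, (π : Measure ℝ) (Set.Icc (-b) b) = 1 →
          ∀ n : ℕ, n₀ ≤ n →
          -- an i.i.d. sample of size `n` from `p_π`
          ∀ (Ω : Type*) [MeasurableSpace Ω] (P : Measure Ω) [IsProbabilityMeasure P]
            (X : Fin n → Ω → ℝ), iIndepFun X P →
            (∀ i, HasLaw (X i) (ExpFamily.mixLaw ν p₀ π) P) →
            -- outside an event of probability at most `2 n ^ (-β)`, an NPMLE exists and
            -- every NPMLE has at most `C log n` atoms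
            P {ω | ¬ ((∃ πhat, ExpFamily.IsNPMLE ν p₀ (fun i => X i ω) πhat) ∧
                ∀ πhat, ExpFamily.IsNPMLE ν p₀ (fun i => X i ω) πhat →
                  ExpFamily.AtMostAtoms πhat (C * Real.log n))}
              ≤ ENNReal.ofReal (2 * (n : ℝ) ^ (-β)) := by
  obtain ⟨k, hk⟩ := pow_unbounded_of_one_lt (K₁ + β + 2)
    (show 1 < K₀ / 2 by linarith)
  have hK₁0 : 0 < K₁ := by linarith
  have hlog2 : 0 < Real.log 2 := Real.log_pos one_lt_two
  refine ⟨(2 + K₁ ^ (k + 3)) / Real.log 2, by positivity, fun θ₀ hθ₀ v hv => ?_⟩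
  -- With `2 ^ m * θ₀ > b`, the threshold on `n` gives `log n > K₁ ^ m * v ≥ κ (2 ^ m * θ₀)`, which
  -- later forces `s > b` and `s ≥ θ₀`.
  obtain ⟨m, hm⟩ := pow_unbounded_of_one_lt (b / θ₀) (one_lt_two (α := ℝ))
  rw [div_lt_iff₀ hθ₀] at hm
  refine ⟨max 2 (⌈Real.exp (K₁ ^ m * v)⌉₊ + 1), ?_⟩
  intro ν _ p₀ hp₀ hprob hsymm hint hgrow hv₀ π hπ n hn Ω _ P _ X _ hX
  have hn2 : (2 : ℝ) ≤ n := by exact_mod_cast (le_max_left _ _).trans hn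
  have hn0 : (0 : ℝ) < n := by linarith
  have hnlog2 : Real.log 2 ≤ Real.log n := Real.log_le_log two_pos hn2
  have hlogn : K₁ ^ m * v < Real.log n := by
    rw [Real.lt_log_iff_exp_lt hn0]
    refine (Nat.le_ceil _).trans_lt ?_
    exact_mod_cast (le_max_right 2 _).trans hn
  have hlogn0 : 0 < Real.log n := hlog2.trans_le hnlog2
  set κ := ExpFamily.logMGF ν p₀ with hκdef
  have hcont : Continuous κ := ExpFamily.continuous_cgf_id hint
  have hmono : ∀ {x y : ℝ}, |x| ≤ |y| → κ x ≤ κ y := fun h =>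
    ExpFamily.cgf_id_mono hsymm hint h
  have hgrow' : ∀ θ, θ₀ ≤ θ → ∀ j : ℕ,
      K₀ ^ j * κ θ ≤ κ (2 ^ j * θ) ∧ κ (2 ^ j * θ) ≤ K₁ ^ j * κ θ := fun θ hθ j =>
    ExpFamily.pow_growth (by linarith) hK₁0.le hθ₀.le
      (fun y hy => ExpFamily.growth_of_continuous (θ := y) hcont hgrow hy) hθ j
  -- the scale at which the log-MGF equals `log n`
  obtain ⟨s, hs0, hs⟩ : ∃ s, 0 ≤ s ∧ κ s = Real.log n := by
    obtain ⟨j, hj⟩ := pow_unbounded_of_one_lt (Real.log n / v) (show 1 < K₀ by linarith)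
    rw [div_lt_iff₀ hv] at hj
    obtain ⟨s, hs⟩ : Real.log n ∈ Set.range κ := by
      refine mem_range_of_exists_le_of_exists_ge hcont ⟨0, ?_⟩ ⟨2 ^ j * θ₀, ?_⟩
      · simpa [hκdef, ExpFamily.logMGF] using hlogn0.le
      · have := (hgrow' θ₀ le_rfl j).1
        rw [hv₀] at this
        linarith
    exact ⟨|s|, abs_nonneg s, (ExpFamily.cgf_id_abs hsymm s).trans hs⟩
  have hms : 2 ^ m * θ₀ < s := by
    by_contra! h
    have h1 : κ s ≤ κ (2 ^ m * θ₀) := hmono (by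
      rwa [abs_of_nonneg hs0, abs_of_pos (by positivity)])
    have h2 := (hgrow' θ₀ le_rfl m).2
    rw [hv₀] at h2
    linarith
  have hsb : b ≤ s := (hm.trans hms).le
  have hsθ : θ₀ ≤ s :=
    (le_mul_of_one_le_left hθ₀.le (one_le_pow₀ one_le_two)).trans hms.le
  have hspos : 0 < s := hθ₀.trans_le hsθ
  -- In the Chernoff exponent, `K₁` absorbs `κ (s + b) ≤ κ (2 * s)`, `1` pays for the union bound,
  -- and `β` is the remaining rate.
  set t := (K₁ + 1 + β) * Real.log n / s with ht
  have hst : s * t = (K₁ + 1 + β) * Real.log n := by rw [ht]; field_simp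
  have hκsb : κ (s + b) ≤ K₁ * Real.log n := by
    have h1 : κ (s + b) ≤ κ (2 * s) := hmono (by
      rw [abs_of_pos (by positivity), abs_of_pos (by positivity)]
      linarith)
    have h2 := (hgrow' s hsθ 1).2
    rw [pow_one, pow_one, hs] at h2
    exact h1.trans h2
  have hr : 0 < 2 ^ k * s := by positivity
  have hrt : 2 ^ k * s * t + Real.log 2 ≤ κ (2 ^ k * s) := by
    have h1 := (hgrow' s hsθ k).1
    rw [hs] at h1
    refine le_trans ?_ h1
    have h2 : (1 : ℝ) ≤ 2 ^ k := one_le_pow₀ one_le_two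
    have h3 : Real.log n ≤ 2 ^ k * Real.log n := le_mul_of_one_le_left hlogn0.le h2
    have h4 : (K₁ + β + 2) * 2 ^ k ≤ K₀ ^ k := by
      rw [div_pow, lt_div_iff₀ (by positivity)] at hk
      exact hk.le
    have h5 := mul_le_mul_of_nonneg_right h4 hlogn0.le
    rw [mul_assoc, hst]
    linarith
  have hC : 2 * Real.log 2 + κ (8 * (2 ^ k * s)) ≤
      (2 + K₁ ^ (k + 3)) / Real.log 2 * Real.log n * Real.log 2 := by
    have h1 := (hgrow' s hsθ (k + 3)).2
    rw [hs] at h1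
    have h2 : (2 + K₁ ^ (k + 3)) / Real.log 2 * Real.log n * Real.log 2 =
        2 * Real.log n + K₁ ^ (k + 3) * Real.log n := by
      field_simp
    have h3 : (8 : ℝ) * (2 ^ k * s) = 2 ^ (k + 3) * s := by ring
    rw [h2, h3]
    linarith
  have hn' : 0 < n := by exact_mod_cast hn0
  calc P _ ≤ P {ω | ∃ i, t < |X i ω| ∨ p₀ (X i ω) = 0} := by
        refine measure_mono fun ω hω => ?_
        by_contra hgood
        simp only [Set.mem_ofPred_eq, not_exists, not_or, not_lt] at hgood
        exact hω (ExpFamily.exists_isNPMLE_and_atoms_le hsymm hint hr hrt hn'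
          (fun i => (hgood i).1) (fun i => (hgood i).2) hC)
    _ ≤ ENNReal.ofReal (n * (2 * Real.exp (κ (s + b) - s * t))) :=
        ExpFamily.measure_exists_abs_gt_or_le hp₀ hsymm hint hs0 hπ hX
    _ ≤ ENNReal.ofReal (2 * (n : ℝ) ^ (-β)) := by
        refine ENNReal.ofReal_le_ofReal ?_
        have h1 : Real.exp (κ (s + b) - s * t) ≤ Real.exp (-Real.log n + Real.log n * -β) := by
          refine Real.exp_le_exp.2 ?_
          rw [hst]
          linarith
        rw [Real.exp_add, Real.exp_neg, Real.exp_log hn0, ← Real.rpow_def_of_pos hn0] at h1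
        calc (n : ℝ) * (2 * Real.exp (κ (s + b) - s * t))
            ≤ n * (2 * ((n : ℝ)⁻¹ * (n : ℝ) ^ (-β))) := by gcongr
          _ = 2 * (n : ℝ) ^ (-β) := by field_simp
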